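/- Let $\mathbb{K}$ be a field of characteristic $0$. Let $\mathcal{W}$ be the Witt algebra, the Lie algebra over $\mathbb{K}$ with basis $\{e_n\}_{n\in\mathbb{Z}}$ and bracket $[e_n,e_m]=(m-n)e_{n+m}$. Let $\mathcal{V}=\mathbb{K}\oplus\mathcal{W}$ be the Virasoro algebra, with $\hat e_n=(0,e_n)$, $t=(1,0)$ and bracket $[\hat e_n,\hat e_m]=(m-n)\hat e_{n+m}-\frac{1}{12}(n^3-n)\,\delta_{n,-m}\,t$, $[\hat e_n,t]=[t,t]=0$. For a Lie algebra $\mathcal{L}$ over $\mathbb{K}$ let $\mathrm{H}^3(\mathcal{L},\mathbb{K})$ be the (algebraic) Chevalley–Eilenberg cohomology with values in the trivial module $\mathbb{K}$, that is, $3$-cocycles modulo $3$-coboundaries, where $q$-cochains are all alternating $q$-multilinear maps $\mathcal{L}^q\to\mathbb{K}$. Then $$\dim \mathrm{H}^3(\mathcal{W},\mathbb{K})=\dim \mathrm{H}^3(\mathcal{V},\mathbb{K})=1 .$$ Moreover, for every $A\in\mathbb{K}\setminus\{0\}$ there is a $3$-cocycle $\mathscr{GV}$ of $\mathcal{W}$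 with values in $\mathbb{K}$ such that, for all $n,m,k\in\mathbb{Z}$, $$\mathscr{GV}(e_n,e_m,e_k)=\begin{cases}A(m-n)(2m+n)(m+2n) & \text{if } k=-(n+m),\\ 0 & \text{otherwise,}\end{cases}$$ and there is a $3$-cocycle of $\mathcal{V}$ with values in $\mathbb{K}$ that is given by the same formula on the $\hat e_n$ and satisfies $\mathscr{GV}(\hat e_n,\hat e_m,t)=0$ for all $n,m$. These cocycles are nonzero on $(e_1,e_0,e_{-1})$, respectively $(\hat e_1,\hat e_0,\hat e_{-1})$, whereas every $3$-coboundary of $\mathcal{W}$, respectively $\mathcal{V}$, with values in $\mathbb{K}$ vanishes there. -/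

import Mathlib

set_option linter.unusedSectionVars false
set_option linter.unnecessarySeqFocus false

/-! ## The Chevalley-Eilenberg complex -/

namespace ChevalleyEilenberg

section

variable (K : Type*) [Field K] [CharZero K]
variable (L : Type*) [LieRing L] [LieAlgebra K L]
variable (M : Type*) [AddCommGroup M] [Module K M] [LieRingModule L M] [LieModule K L M]

/-- The space `C^q(L, M)` of `q`-cochains: alternating `q`-multilinear maps from `L` to `M`. -/
abbrev Cochain (q : ℕ) : Type _ := L [⋀^Fin q]→ₗ[K] M

/-- The ground field `K` as a trivial `L`-module: `x · c = 0`. -/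
abbrev Trivial : Type _ := TrivialLieModule K L K

variable {K L M}

/-- The value `(δ ψ)(x_0, …, x_q)` of the Chevalley-Eilenberg coboundary of a `q`-cochain `ψ`.
With indices starting at `0` it is
`∑_{a < b} (-1)^(a+b+1) ψ([x_a, x_b], x_0, …, x̂_a, …, x̂_b, …, x_q)`
`+ ∑_a (-1)^(a+1) x_a · ψ(x_0, …, x̂_a, …, x_q)`.
A pair `a < b` is encoded as `a = i.castSucc`, `b = j.succ` with `i ≤ j`, so that
`(-1)^(a+b+1) = (-1)^(i+j)`. There are no such pairs if `q = 0`. -/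
def coboundaryFun : (q : ℕ) → Cochain K L M q → (Fin (q + 1) → L) → M
  | 0, ψ, x => ∑ a : Fin 1, (-1 : ℤ) ^ ((a : ℕ) + 1) • ⁅x a, ψ (a.removeNth x)⁆
  | n + 1, ψ, x =>
      ∑ i : Fin (n + 1), ∑ j ≥ i, (-1 : ℤ) ^ ((i : ℕ) + (j : ℕ)) •
          ψ (Matrix.vecCons ⁅x i.castSucc, x j.succ⁆ (j.removeNth (i.castSucc.removeNth x)))
        + ∑ a : Fin (n + 2), (-1 : ℤ) ^ ((a : ℕ) + 1) • ⁅x a, ψ (a.removeNth x)⁆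

/-- The linear map `x ↦ (y ↦ x · ψ(y))`. -/
def actionMap {q : ℕ} (ψ : Cochain K L M q) : L →ₗ[K] Cochain K L M q where
  toFun x := (LieModule.toEnd K L M x).compAlternatingMap ψ
  map_add' x y := by ext v; simp
  map_smul' c x := by ext v; simp

/-- The bilinear map `(x, y) ↦ ψ([x, y], -)`. -/
def bracketMap {n : ℕ} (ψ : Cochain K L M (n + 1)) : L →ₗ[K] L →ₗ[K] Cochain K L M n :=
  LinearMap.mk₂ K (fun x y => ψ.curryLeft ⁅x, y⁆)
    (by intros; simp) (by intros; simp) (by intros; simp) (by intros; simp)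

/-- The coboundary as an alternating map, assembled from alternatizations. -/
def coboundaryAux : (q : ℕ) → Cochain K L M q → Cochain K L M (q + 1)
  | 0, ψ => -AlternatingMap.alternatizeUncurryFin (actionMap ψ)
  | _ + 1, ψ =>
      (2⁻¹ : K) • AlternatingMap.alternatizeUncurryFin
          (AlternatingMap.alternatizeUncurryFinLM ∘ₗ bracketMap ψ)
        - AlternatingMap.alternatizeUncurryFin (actionMap ψ)

theorem coboundaryAux_apply (q : ℕ) (ψ : Cochain K L M q) (x : Fin (q + 1) → L) :
    coboundaryAux q ψ x = coboundaryFun q ψ x := by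
  cases q with
  | zero =>
    simp [coboundaryAux, coboundaryFun, AlternatingMap.alternatizeUncurryFin_apply, actionMap]
  | succ n =>
    have key : ∀ y z : L, bracketMap ψ y z - bracketMap ψ z y = (2 : K) • bracketMap ψ y z := by
      intro y z
      have h : bracketMap ψ z y = -bracketMap ψ y z := by
        simp only [bracketMap, LinearMap.mk₂_apply]
        rw [← lie_skew z y, map_neg]
      rw [h, two_smul, sub_neg_eq_add]
    rw [coboundaryAux, AlternatingMap.sub_apply, AlternatingMap.smul_apply,
      AlternatingMap.alternatizeUncurryFin_alternatizeUncurryFinLM_comp_apply, coboundaryFun,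
      sub_eq_add_neg]
    congr 1
    · rw [Finset.smul_sum]
      refine Finset.sum_congr rfl fun i _ => ?_
      rw [Finset.smul_sum]
      refine Finset.sum_congr rfl fun j _ => ?_
      rw [← AlternatingMap.sub_apply, key, AlternatingMap.smul_apply, smul_comm, smul_smul,
        inv_mul_cancel₀ (two_ne_zero), one_smul]
      rfl
    · rw [AlternatingMap.alternatizeUncurryFin_apply, ← Finset.sum_neg_distrib]
      refine Finset.sum_congr rfl fun a _ => ?_
      rw [pow_succ, mul_neg_one, neg_smul]
      rfl

variable (K L M)

/-- The Chevalley-Eilenberg coboundary operator `δ_q : C^q(L, M) → C^{q+1}(L, M)`. -/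
def coboundary (q : ℕ) : Cochain K L M q →ₗ[K] Cochain K L M (q + 1) where
  toFun ψ :=
    { toFun := coboundaryFun q ψ
      map_update_add' := by
        intro _ x i a b
        simp only [← coboundaryAux_apply]
        convert (coboundaryAux q ψ).map_update_add x i a b
      map_update_smul' := by
        intro _ x i c a
        simp only [← coboundaryAux_apply]
        convert (coboundaryAux q ψ).map_update_smul x i c a
      map_eq_zero_of_eq' := by
        intro x i j h hij
        simp only [← coboundaryAux_apply]
        exact (coboundaryAux q ψ).map_eq_zero_of_eq x h hij }
  map_add' ψ φ := by
    ext x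
    cases q <;> simp [coboundaryFun, Finset.sum_add_distrib] <;> abel
  map_smul' c ψ := by
    ext x
    cases q <;> simp [coboundaryFun, Finset.smul_sum, smul_comm _ c]

/-- The space `Z^q(L, M)` of `q`-cocycles. -/
def cocycles (q : ℕ) : Submodule K (Cochain K L M q) :=
  LinearMap.ker (coboundary K L M q)

/-- The space `B^q(L, M)` of `q`-coboundaries (zero for `q = 0`). -/
def coboundaries : (q : ℕ) → Submodule K (Cochain K L M q)
  | 0 => ⊥
  | q + 1 => LinearMap.range (coboundary K L M q)

/-- The cohomology space `H^q(L, M) = Z^q(L, M) / B^q(L, M)`. -/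
abbrev Cohomology (q : ℕ) : Type _ :=
  cocycles K L M q ⧸ (coboundaries K L M q).submoduleOf (cocycles K L M q)

end

end ChevalleyEilenberg

/-! ## The Witt algebra -/

section

variable (K : Type*) [Field K] [CharZero K]

/-- The Witt algebra over `K`: the vector space with basis `e_n`, `n ∈ ℤ`. -/
def Witt : Type _ := ℤ →₀ K

namespace Witt

noncomputable instance : AddCommGroup (Witt K) := inferInstanceAs (AddCommGroup (ℤ →₀ K))

noncomputable instance : Module K (Witt K) := inferInstanceAs (Module K (ℤ →₀ K))

/-- The basis of the Witt algebra. -/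
noncomputable def basis : Module.Basis ℤ K (Witt K) := ⟨LinearEquiv.refl K (ℤ →₀ K)⟩

/-- The basis element `e_n`. -/
noncomputable def e (n : ℤ) : Witt K := basis K n

/-- The bilinear map with `(e_n, e_m) ↦ (m - n) e_{n+m}`. -/
noncomputable def bracketLM : Witt K →ₗ[K] Witt K →ₗ[K] Witt K :=
  (basis K).constr K fun n => (basis K).constr K fun m => ((m : K) - (n : K)) • e K (n + m)

theorem bracketLM_e (n m : ℤ) :
    bracketLM K (e K n) (e K m) = ((m : K) - (n : K)) • e K (n + m) := by
  simp only [bracketLM, e, Module.Basis.constr_basis]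

variable {K} in
theorem induction_e {p : Witt K → Prop} (x : Witt K) (zero : p 0)
    (add : ∀ a b, p a → p b → p (a + b)) (smul : ∀ (c : K) a, p a → p (c • a))
    (basis : ∀ n, p (e K n)) : p x := by
  have hx : x ∈ Submodule.span K (Set.range (Witt.basis K)) := by
    rw [Module.Basis.span_eq]; trivial
  induction hx using Submodule.span_induction with
  | mem y hy => obtain ⟨n, rfl⟩ := hy; exact basis n
  | zero => exact zero
  | add a b _ _ ha hb => exact add a b ha hb
  | smul c a _ ha => exact smul c a ha

variable {K} in
theorem eq_zero_of_eq_neg {V : Type*} [AddCommGroup V] [Module K V] {v : V} (h : v = -v) :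
    v = 0 := by
  have h2 : (2 : K) • v = 0 := by
    rw [two_smul]
    nth_rewrite 2 [h]
    exact add_neg_cancel v
  exact (smul_eq_zero.mp h2).resolve_left two_ne_zero

theorem bracketLM_skew (x y : Witt K) : bracketLM K x y = -bracketLM K y x := by
  have h : bracketLM K = -(bracketLM K).flip := by
    refine (basis K).ext fun n => (basis K).ext fun m => ?_
    change bracketLM K (e K n) (e K m) = -bracketLM K (e K m) (e K n)
    rw [bracketLM_e, bracketLM_e, ← neg_smul, neg_sub, add_comm]
  exact LinearMap.congr_fun (LinearMap.congr_fun h x) y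

theorem bracketLM_jacobi (x y z : Witt K) :
    bracketLM K x (bracketLM K y z) =
      bracketLM K (bracketLM K x y) z + bracketLM K y (bracketLM K x z) := by
  induction x using Witt.induction_e with
  | zero => simp
  | add a b ha hb => simp only [map_add, LinearMap.add_apply, ha, hb]; abel
  | smul c a ha => simp only [map_smul, LinearMap.smul_apply, ha, smul_add]
  | basis n =>
  induction y using Witt.induction_e with
  | zero => simp
  | add a b ha hb => simp only [map_add, LinearMap.add_apply, ha, hb]; abel
  | smul c a ha => simp only [map_smul, LinearMap.smul_apply, ha, smul_add]
  | basis m =>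
  induction z using Witt.induction_e with
  | zero => simp
  | add a b ha hb => simp only [map_add, ha, hb]; abel
  | smul c a ha => simp only [map_smul, ha, smul_add]
  | basis k =>
  simp only [bracketLM_e, map_smul, LinearMap.smul_apply, smul_smul]
  rw [show n + m + k = n + (m + k) by ring, show m + (n + k) = n + (m + k) by ring, ← add_smul]
  congr 1
  push_cast
  ring

noncomputable instance : LieRing (Witt K) where
  bracket x y := bracketLM K x y
  add_lie x y z := by simp
  lie_add x y z := by simp
  lie_self x := eq_zero_of_eq_neg (K := K) (bracketLM_skew K x x)
  leibniz_lie x y z := bracketLM_jacobi K x y z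

noncomputable instance : LieAlgebra K (Witt K) where
  lie_smul c x y := map_smul (bracketLM K x) c y

/-- The structure equation `[e_n, e_m] = (m - n) e_{n+m}`. -/
theorem lie_e (n m : ℤ) : ⁅e K n, e K m⁆ = ((m : K) - (n : K)) • e K (n + m) :=
  bracketLM_e K n m

end Witt

/-! ## The Virasoro algebra -/

/-- The Virasoro algebra over `K`: the vector space `K ⊕ W`. -/
def Virasoro : Type _ := K × Witt K

namespace Virasoro

noncomputable instance : AddCommGroup (Virasoro K) := inferInstanceAs (AddCommGroup (K × Witt K))

noncomputable instance : Module K (Virasoro K) := inferInstanceAs (Module K (K × Witt K))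

/-- The element `ê_n = (0, e_n)`. -/
noncomputable def e (n : ℤ) : Virasoro K := ((0 : K), Witt.e K n)

/-- The central element `t = (1, 0)`. -/
noncomputable def t : Virasoro K := ((1 : K), (0 : Witt K))

/-- The bilinear form with `(e_n, e_m) ↦ -(n^3 - n)/12` if `n = -m`, and `0` otherwise. -/
noncomputable def centralForm : Witt K →ₗ[K] Witt K →ₗ[K] K :=
  (Witt.basis K).constr K fun n => (Witt.basis K).constr K fun m =>
    if n = -m then -(1 / 12 : K) * ((n : K) ^ 3 - (n : K)) else 0

theorem centralForm_e (n m : ℤ) : centralForm K (Witt.e K n) (Witt.e K m) =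
    if n = -m then -(1 / 12 : K) * ((n : K) ^ 3 - (n : K)) else 0 := by
  simp only [centralForm, Witt.e, Module.Basis.constr_basis]

theorem centralForm_skew (x y : Witt K) : centralForm K x y = -centralForm K y x := by
  have h : centralForm K = -(centralForm K).flip := by
    refine (Witt.basis K).ext fun n => (Witt.basis K).ext fun m => ?_
    change centralForm K (Witt.e K n) (Witt.e K m) = -centralForm K (Witt.e K m) (Witt.e K n)
    rw [centralForm_e, centralForm_e]
    by_cases hnm : n = -m
    · subst hnm
      simp only [neg_neg, if_true]
      push_cast
      ring
    · rw [if_neg hnm, if_neg (fun h => hnm (by omega)), neg_zero]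
  exact LinearMap.congr_fun (LinearMap.congr_fun h x) y

theorem centralForm_jacobi (x y z : Witt K) :
    centralForm K x ⁅y, z⁆ = centralForm K ⁅x, y⁆ z + centralForm K y ⁅x, z⁆ := by
  induction x using Witt.induction_e with
  | zero => simp
  | add a b ha hb => simp only [map_add, add_lie, LinearMap.add_apply, ha, hb]; abel
  | smul c a ha => simp only [map_smul, smul_lie, LinearMap.smul_apply, ha, smul_add]
  | basis n =>
  induction y using Witt.induction_e with
  | zero => simp
  | add a b ha hb => simp only [map_add, add_lie, lie_add, LinearMap.add_apply, ha, hb]; abel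
  | smul c a ha =>
    simp only [map_smul, smul_lie, lie_smul, LinearMap.smul_apply, ha, smul_add]
  | basis m =>
  induction z using Witt.induction_e with
  | zero => simp
  | add a b ha hb => simp only [map_add, lie_add, ha, hb]; abel
  | smul c a ha => simp only [map_smul, lie_smul, ha, smul_add]
  | basis k =>
  simp only [Witt.lie_e, map_smul, LinearMap.smul_apply, centralForm_e, smul_eq_mul]
  by_cases h : n + m + k = 0
  · obtain rfl : k = -(n + m) := by omega
    rw [if_pos (by ring), if_pos (by ring), if_pos (by ring)]
    push_cast
    ring
  · rw [if_neg (fun h' => h (by omega)), if_neg (fun h' => h (by omega)),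
      if_neg (fun h' => h (by omega))]
    ring

/-- The bracket `[(a, x), (b, y)] = (α(x, y), [x, y])`, where `α` is the form `centralForm`. -/
noncomputable instance : Bracket (Virasoro K) (Virasoro K) where
  bracket x y := (centralForm K x.2 y.2, ⁅x.2, y.2⁆)

theorem lie_def (x y : Virasoro K) : ⁅x, y⁆ = (centralForm K x.2 y.2, ⁅x.2, y.2⁆) := rfl

noncomputable instance : LieRing (Virasoro K) where
  add_lie x y z := Prod.ext
    ((LinearMap.congr_fun (map_add (centralForm K) x.2 y.2) z.2)) (add_lie x.2 y.2 z.2)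
  lie_add x y z := Prod.ext (map_add (centralForm K x.2) y.2 z.2) (lie_add x.2 y.2 z.2)
  lie_self x := Prod.ext (Witt.eq_zero_of_eq_neg (K := K) (centralForm_skew K x.2 x.2)) (lie_self x.2)
  leibniz_lie x y z := Prod.ext (centralForm_jacobi K x.2 y.2 z.2) (leibniz_lie x.2 y.2 z.2)

noncomputable instance : LieAlgebra K (Virasoro K) where
  lie_smul c x y := Prod.ext (map_smul (centralForm K x.2) c y.2) (lie_smul c x.2 y.2)

/-- The structure equation
`[ê_n, ê_m] = (m - n) ê_{n+m} - (1/12) (n^3 - n) δ_{n,-m} t`. -/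
theorem lie_e (n m : ℤ) : ⁅e K n, e K m⁆ = ((m : K) - (n : K)) • e K (n + m)
    - ((1 / 12 : K) * ((n : K) ^ 3 - (n : K)) * (if n = -m then 1 else 0)) • t K := by
  refine Prod.ext ?_ ?_
  · change centralForm K (Witt.e K n) (Witt.e K m) = ((m : K) - (n : K)) * 0
      - ((1 / 12 : K) * ((n : K) ^ 3 - (n : K)) * (if n = -m then 1 else 0)) * 1
    rw [centralForm_e]
    split_ifs <;> ring
  · change ⁅Witt.e K n, Witt.e K m⁆ = ((m : K) - (n : K)) • Witt.e K (n + m)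
      - ((1 / 12 : K) * ((n : K) ^ 3 - (n : K)) * (if n = -m then 1 else 0)) • (0 : Witt K)
    rw [Witt.lie_e, smul_zero, sub_zero]

/-- The element `t` is central. -/
theorem lie_t (x : Virasoro K) : ⁅x, t K⁆ = 0 :=
  Prod.ext (map_zero (centralForm K x.2)) (lie_zero x.2)

end Virasoro

end

/-! Both halves rest on evaluation at the `sl₂` triple (`e_1`, `e_0`, `e_{-1}`). It kills every
coboundary: on this triple the brackets are those of `sl₂`, since `n³ - n` vanishes at `0, ±1`, and
the remaining terms cancel by alternation. It does not kill the Godbillon-Vey cocycle. So dimension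
one amounts to showing that a cocycle vanishing at this triple is exact
(`rank_cohomology_three_eq_one`).

Witt algebra (`Witt.exists_eq_dTwo`). Since `e_0` acts on the part of degree `d` by the scalar `d`,
contraction with `e_0` makes everything outside degree zero exact. In degree zero, a further
coboundary makes the contraction with `e_1` vanish; the only obstruction to this is the value at the
`sl₂` triple. A degree-zero cocycle killed by `e_1` is zero: the cocycle condition becomes a
two-term recursion in the index, and induction on the largest absolute index applies
(`eq_zero_of_normalized`). The recursion has degenerate places, and the smallest of these needs a
finite computation.

Virasoro algebra (`Virasoro.exists_eq_dTwo`). The contraction of a cocycle with the central `t` is a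
`2`-cocycle of the Witt algebra, hence, up to a coboundary, a multiple `a` of the cubic cocycle `ω`
(`exists_eq_of_twoCocycle`). The cocycle condition on the `ê_n` then makes a multiple of `a · ω ∧ ω`
exact on the Witt algebra. As `ω ∧ ω` is not exact (`eq_zero_of_cup_square`), `a = 0`; the cocycle
is therefore a pullback from the Witt algebra, where the first half applies. -/

namespace AlternatingMap

/-! ### Alternating forms in two and three arguments -/

section

variable {R V M : Type*} [CommRing R] [AddCommGroup V] [Module R V] [AddCommGroup M] [Module R M]

theorem map_pair_add_left (f : V [⋀^Fin 2]→ₗ[R] M) (x x' y : V) :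
    f ![x + x', y] = f ![x, y] + f ![x', y] := by
  simpa only [curryLeft_apply_apply, add_apply] using
    congrArg (fun g => g ![y]) (f.curryLeft.map_add x x')

theorem map_pair_smul_left (f : V [⋀^Fin 2]→ₗ[R] M) (c : R) (x y : V) :
    f ![c • x, y] = c • f ![x, y] := by
  simpa only [curryLeft_apply_apply, smul_apply] using
    congrArg (fun g => g ![y]) (f.curryLeft.map_smul c x)

theorem map_pair_self (f : V [⋀^Fin 2]→ₗ[R] M) (x : V) : f ![x, x] = 0 :=
  f.map_eq_zero_of_eq ![x, x] (i := 0) (j := 1) rfl (by decide)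

theorem map_pair_swap (f : V [⋀^Fin 2]→ₗ[R] M) (x y : V) : f ![y, x] = -f ![x, y] := by
  have h := f.map_swap ![x, y] (i := 0) (j := 1) (by decide)
  rw [← h]
  congr 1
  ext i
  fin_cases i <;> rfl

theorem map_triple_add_left (f : V [⋀^Fin 3]→ₗ[R] M) (x x' y z : V) :
    f ![x + x', y, z] = f ![x, y, z] + f ![x', y, z] := by
  simpa only [curryLeft_apply_apply, add_apply] using
    congrArg (fun g => g ![y, z]) (f.curryLeft.map_add x x')

theorem map_triple_smul_left (f : V [⋀^Fin 3]→ₗ[R] M) (c : R) (x y z : V) :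
    f ![c • x, y, z] = c • f ![x, y, z] := by
  simpa only [curryLeft_apply_apply, smul_apply] using
    congrArg (fun g => g ![y, z]) (f.curryLeft.map_smul c x)

theorem map_triple_swap_right (f : V [⋀^Fin 3]→ₗ[R] M) (x y z : V) :
    f ![x, z, y] = -f ![x, y, z] :=
  map_pair_swap (f.curryLeft x) y z

theorem map_triple_swap_left (f : V [⋀^Fin 3]→ₗ[R] M) (x y z : V) :
    f ![y, x, z] = -f ![x, y, z] := by
  have h := f.map_swap ![x, y, z] (i := 0) (j := 1) (by decide)
  rw [← h]
  congr 1
  ext i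
  fin_cases i <;> rfl

theorem map_triple_eq_zero_right (f : V [⋀^Fin 3]→ₗ[R] M) (x y : V) : f ![x, y, y] = 0 :=
  map_pair_self (f.curryLeft x) y

theorem map_triple_rotate (f : V [⋀^Fin 3]→ₗ[R] M) (x y z : V) :
    f ![z, x, y] = f ![x, y, z] := by
  rw [map_triple_swap_left, map_triple_swap_right, neg_neg]

theorem map_triple_eq_zero_left (f : V [⋀^Fin 3]→ₗ[R] M) (x y : V) : f ![x, x, y] = 0 := by
  rw [← map_triple_rotate, map_triple_eq_zero_right]

theorem compLinearMap_triple {V' : Type*} [AddCommGroup V'] [Module R V']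
    (f : V' [⋀^Fin 3]→ₗ[R] M) (g : V →ₗ[R] V') (x y z : V) :
    f.compLinearMap g ![x, y, z] = f ![g x, g y, g z] := by
  rw [AlternatingMap.compLinearMap_apply]
  congr 1
  ext i
  fin_cases i <;> rfl

theorem compLinearMap_pair {V' : Type*} [AddCommGroup V'] [Module R V']
    (f : V' [⋀^Fin 2]→ₗ[R] M) (g : V →ₗ[R] V') (x y : V) :
    f.compLinearMap g ![x, y] = f ![g x, g y] := by
  rw [AlternatingMap.compLinearMap_apply]
  congr 1
  ext i
  fin_cases i <;> rfl

/-- The alternating map attached to an alternating bilinear map. -/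
def ofIsAlt (B : V →ₗ[R] V →ₗ[R] M) (hB : ∀ x, B x x = 0) : V [⋀^Fin 2]→ₗ[R] M where
  toFun v := B (v 0) (v 1)
  map_update_add' := by
    intro inst v i x y
    obtain rfl : inst = instDecidableEqFin 2 := Subsingleton.elim _ _
    fin_cases i <;> simp
  map_update_smul' := by
    intro inst v i c x
    obtain rfl : inst = instDecidableEqFin 2 := Subsingleton.elim _ _
    fin_cases i <;> simp
  map_eq_zero_of_eq' := by
    intro v i j hv hij
    have h : v 0 = v 1 := by
      fin_cases i <;> fin_cases j <;> first | exact hv | exact hv.symm | exact absurd rfl hij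
    rw [h, hB]

theorem ofIsAlt_apply (B : V →ₗ[R] V →ₗ[R] M) (hB : ∀ x, B x x = 0) (x y : V) :
    ofIsAlt B hB ![x, y] = B x y := rfl

end

end AlternatingMap

/-! ### Scalar cocycles and coboundaries in degree three -/

namespace ChevalleyEilenberg

open AlternatingMap

section

variable {K : Type*} [Field K] [CharZero K] {L : Type*} [LieRing L] [LieAlgebra K L]

theorem coboundary_two_apply (φ : Cochain K L (Trivial K L) 2) (x y z : L) :
    coboundary K L (Trivial K L) 2 φ ![x, y, z] =
      φ ![⁅x, y⁆, z] - φ ![⁅x, z⁆, y] + φ ![⁅y, z⁆, x] := by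
  have h01 : (1 : Fin 2).removeNth ((0 : Fin 3).removeNth ![x, y, z]) = ![y] := by
    ext i; fin_cases i; rfl
  have h00 : (0 : Fin 2).removeNth ((0 : Fin 3).removeNth ![x, y, z]) = ![z] := by
    ext i; fin_cases i; rfl
  have h11 : (1 : Fin 2).removeNth ((1 : Fin 3).removeNth ![x, y, z]) = ![x] := by
    ext i; fin_cases i; rfl
  have e0 : Finset.Ici (0 : Fin 2) = {0, 1} := by decide
  have e1 : Finset.Ici (1 : Fin 2) = {1} := by decide
  change coboundaryFun 2 φ ![x, y, z] = _
  simp [coboundaryFun, Fin.sum_univ_succ, e0, e1, h00, h01, h11, trivial_lie_zero,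
    -Fin.removeNth_zero]
  abel

theorem coboundary_three_apply (φ : Cochain K L (Trivial K L) 3) (x y z w : L) :
    coboundary K L (Trivial K L) 3 φ ![x, y, z, w] =
      φ ![⁅x, y⁆, z, w] - φ ![⁅x, z⁆, y, w] + φ ![⁅x, w⁆, y, z] + φ ![⁅y, z⁆, x, w]
        - φ ![⁅y, w⁆, x, z] + φ ![⁅z, w⁆, x, y] := by
  have h00 : (0 : Fin 3).removeNth ((0 : Fin 4).removeNth ![x, y, z, w]) = ![z, w] := by
    ext i; fin_cases i <;> rfl
  have h01 : (1 : Fin 3).removeNth ((0 : Fin 4).removeNth ![x, y, z, w]) = ![y, w] := by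
    ext i; fin_cases i <;> rfl
  have h02 : (2 : Fin 3).removeNth ((0 : Fin 4).removeNth ![x, y, z, w]) = ![y, z] := by
    ext i; fin_cases i <;> rfl
  have h11 : (1 : Fin 3).removeNth ((1 : Fin 4).removeNth ![x, y, z, w]) = ![x, w] := by
    ext i; fin_cases i <;> rfl
  have h12 : (2 : Fin 3).removeNth ((1 : Fin 4).removeNth ![x, y, z, w]) = ![x, z] := by
    ext i; fin_cases i <;> rfl
  have h22 : (2 : Fin 3).removeNth ((2 : Fin 4).removeNth ![x, y, z, w]) = ![x, y] := by
    ext i; fin_cases i <;> rfl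
  have e0 : Finset.Ici (0 : Fin 3) = {0, 1, 2} := by decide
  have e1 : Finset.Ici (1 : Fin 3) = {1, 2} := by decide
  have e2 : Finset.Ici (2 : Fin 3) = {2} := by decide
  change coboundaryFun 3 φ ![x, y, z, w] = _
  simp [coboundaryFun, Fin.sum_univ_succ, e0, e1, e2, h00, h01, h02, h11, h12, h22,
    trivial_lie_zero, -Fin.removeNth_zero]
  abel

/-- The Chevalley-Eilenberg coboundary of a scalar `2`-form. -/
noncomputable def dTwo (φ : L [⋀^Fin 2]→ₗ[K] K) : L [⋀^Fin 3]→ₗ[K] K :=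
  (TrivialLieModule.equiv K L K).toLinearMap.compAlternatingMap
    (coboundary K L (Trivial K L) 2
      ((TrivialLieModule.equiv K L K).symm.toLinearMap.compAlternatingMap φ))

theorem dTwo_apply (φ : L [⋀^Fin 2]→ₗ[K] K) (x y z : L) :
    dTwo φ ![x, y, z] = φ ![⁅x, y⁆, z] - φ ![⁅x, z⁆, y] + φ ![⁅y, z⁆, x] := by
  rw [dTwo, LinearMap.compAlternatingMap_apply, coboundary_two_apply]
  simp

theorem dTwo_add (φ χ : L [⋀^Fin 2]→ₗ[K] K) : dTwo (φ + χ) = dTwo φ + dTwo χ := by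
  ext v
  have hv : v = ![v 0, v 1, v 2] := by ext i; fin_cases i <;> rfl
  rw [hv]
  simp only [AlternatingMap.add_apply, dTwo_apply]
  ring

/-- The cocycle condition for a scalar `3`-form. -/
def IsCocycleThree (f : L [⋀^Fin 3]→ₗ[K] K) : Prop :=
  ∀ x y z w : L, f ![⁅x, y⁆, z, w] - f ![⁅x, z⁆, y, w] + f ![⁅x, w⁆, y, z] + f ![⁅y, z⁆, x, w]
        - f ![⁅y, w⁆, x, z] + f ![⁅z, w⁆, x, y] = 0

theorem IsCocycleThree.sub {f g : L [⋀^Fin 3]→ₗ[K] K} (hf : IsCocycleThree f)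
    (hg : IsCocycleThree g) : IsCocycleThree (f - g) := by
  intro x y z w
  simp only [AlternatingMap.sub_apply]
  linear_combination hf x y z w - hg x y z w

theorem IsCocycleThree.smul {f : L [⋀^Fin 3]→ₗ[K] K} (hf : IsCocycleThree f) (c : K) :
    IsCocycleThree (c • f) := by
  intro x y z w
  simp only [AlternatingMap.smul_apply, smul_eq_mul]
  linear_combination c * hf x y z w

theorem isCocycleThree_dTwo (φ : L [⋀^Fin 2]→ₗ[K] K) : IsCocycleThree (dTwo φ) := by
  intro x y z w
  have jac : ∀ a b c d : L,
      φ ![⁅⁅a, b⁆, c⁆, d] - φ ![⁅⁅a, c⁆, b⁆, d] + φ ![⁅⁅b, c⁆, a⁆, d] = 0 := by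
    intro a b c d
    have h : ⁅⁅a, b⁆, c⁆ = ⁅⁅a, c⁆, b⁆ + (-1 : K) • ⁅⁅b, c⁆, a⁆ := by
      rw [lie_lie a b c, ← lie_skew ⁅a, c⁆ b, ← lie_skew ⁅b, c⁆ a, neg_one_smul]
      abel
    rw [h, map_pair_add_left, map_pair_smul_left]
    ring
  simp only [dTwo_apply]
  -- In `d² = 0` the doubly nested brackets cancel by Jacobi, once for each choice of the argument
  -- left outside; the terms `φ([x, y], [z, w])` occur in pairs that cancel by antisymmetry.
  linear_combination jac x y z w - jac x y w z + jac x z w y - jac y z w x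
    + map_pair_swap φ ⁅x, y⁆ ⁅z, w⁆ - map_pair_swap φ ⁅x, z⁆ ⁅y, w⁆
    + map_pair_swap φ ⁅x, w⁆ ⁅y, z⁆

theorem isCocycleThree_iff (ψ : Cochain K L (Trivial K L) 3) :
    IsCocycleThree ((TrivialLieModule.equiv K L K).toLinearMap.compAlternatingMap ψ) ↔
      ψ ∈ cocycles K L (Trivial K L) 3 := by
  have key : ∀ x y z w : L,
      TrivialLieModule.equiv K L K (coboundary K L (Trivial K L) 3 ψ ![x, y, z, w]) =
      (fun f : L [⋀^Fin 3]→ₗ[K] K => f ![⁅x, y⁆, z, w] - f ![⁅x, z⁆, y, w] + f ![⁅x, w⁆, y, z]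
        + f ![⁅y, z⁆, x, w] - f ![⁅y, w⁆, x, z] + f ![⁅z, w⁆, x, y])
      ((TrivialLieModule.equiv K L K).toLinearMap.compAlternatingMap ψ) := by
    intro x y z w
    rw [coboundary_three_apply]
    simp
  rw [cocycles, LinearMap.mem_ker]
  constructor
  · intro h
    ext v
    have hv : v = ![v 0, v 1, v 2, v 3] := by ext i; fin_cases i <;> rfl
    rw [hv, AlternatingMap.zero_apply]
    apply (TrivialLieModule.equiv K L K).injective
    rw [key, _root_.map_zero]
    exact h _ _ _ _
  · intro h x y z w
    have h' := key x y z w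
    rw [h, AlternatingMap.zero_apply, _root_.map_zero] at h'
    exact h'.symm

theorem mem_coboundaries_three_iff (ψ : Cochain K L (Trivial K L) 3) :
    ψ ∈ coboundaries K L (Trivial K L) 3 ↔ ∃ φ : L [⋀^Fin 2]→ₗ[K] K,
      (TrivialLieModule.equiv K L K).toLinearMap.compAlternatingMap ψ = dTwo φ := by
  rw [coboundaries, LinearMap.mem_range]
  constructor
  · rintro ⟨φ, rfl⟩
    exact ⟨(TrivialLieModule.equiv K L K).toLinearMap.compAlternatingMap φ, rfl⟩
  · rintro ⟨φ, h⟩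
    refine ⟨(TrivialLieModule.equiv K L K).symm.toLinearMap.compAlternatingMap φ, ?_⟩
    ext v
    exact (congrArg (fun f => f v) h).symm

/-- If a point evaluation detects which `3`-cocycles are coboundaries and does not vanish on all
cocycles, then `H³(L, K)` is one-dimensional. -/
theorem rank_cohomology_three_eq_one (v : Fin 3 → L)
    (hB : ∀ φ : L [⋀^Fin 2]→ₗ[K] K, dTwo φ v = 0)
    (hZ : ∀ f : L [⋀^Fin 3]→ₗ[K] K, IsCocycleThree f → f v = 0 → ∃ φ, f = dTwo φ)
    (g : L [⋀^Fin 3]→ₗ[K] K) (hg : IsCocycleThree g) (hgv : g v ≠ 0) :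
    Module.rank K (Cohomology K L (Trivial K L) 3) = 1 := by
  let ev : cocycles K L (Trivial K L) 3 →ₗ[K] K :=
    { toFun := fun ψ => TrivialLieModule.equiv K L K (ψ.1 v)
      map_add' := fun _ _ => rfl
      map_smul' := fun _ _ => rfl }
  have hker : (coboundaries K L (Trivial K L) 3).submoduleOf (cocycles K L (Trivial K L) 3) =
      LinearMap.ker ev := by
    ext ψ
    rw [Submodule.submoduleOf, Submodule.mem_comap, LinearMap.mem_ker, Submodule.subtype_apply,
      mem_coboundaries_three_iff]
    constructor
    · rintro ⟨φ, h⟩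
      exact (congrArg (fun f => f v) h).trans (hB φ)
    · exact fun h => hZ _ ((isCocycleThree_iff ψ.1).mpr ψ.2) h
  have hsurj : Function.Surjective ev := by
    intro c
    refine ⟨(c / g v) • ⟨(TrivialLieModule.equiv K L K).symm.toLinearMap.compAlternatingMap g,
      (isCocycleThree_iff _).mp hg⟩, ?_⟩
    rw [map_smul, smul_eq_mul]
    exact div_mul_cancel₀ c hgv
  unfold Cohomology
  rw [hker]
  have h := (LinearMap.quotKerEquivOfSurjective ev hsurj).lift_rank_eq
  rw [Module.rank_self, Cardinal.lift_one] at h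
  exact Cardinal.lift_eq_one.mp h

end

end ChevalleyEilenberg

/-! ### Vanishing of degree-zero cocycles killed by `e_1` -/

namespace Witt

section

variable {K : Type*} [Field K] [CharZero K]

/-- The values on the basis of an alternating `3`-form on the Witt algebra. -/
structure AlternatingArray (P : ℤ → ℤ → ℤ → K) : Prop where
  swap_left : ∀ n m k, P m n k = -P n m k
  swap_right : ∀ n m k, P n k m = -P n m k

/-- The values on the basis of an alternating `3`-form on the Witt algebra that satisfies the
cocycle condition. -/
structure CocycleArray (P : ℤ → ℤ → ℤ → K) : Prop extends AlternatingArray P where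
  cocycle : ∀ i j k l : ℤ,
    ((j : K) - i) * P (i + j) k l - ((k : K) - i) * P (i + k) j l + ((l : K) - i) * P (i + l) j k
      + ((k : K) - j) * P (j + k) i l - ((l : K) - j) * P (j + l) i k
      + ((l : K) - k) * P (k + l) i j = 0

namespace AlternatingArray

variable {P : ℤ → ℤ → ℤ → K} (hP : AlternatingArray P)

include hP

theorem rotate (n m k : ℤ) : P k n m = P n m k := by
  rw [hP.swap_left, hP.swap_right, neg_neg]

theorem eq_zero_left (n m : ℤ) : P n n m = 0 :=
  eq_zero_of_eq_neg (K := K) (hP.swap_left n n m)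

theorem eq_zero_right (n m : ℤ) : P n m m = 0 :=
  eq_zero_of_eq_neg (K := K) (hP.swap_right n m m)

theorem eq_zero_outer (n m : ℤ) : P n m n = 0 := by
  rw [hP.swap_right, hP.eq_zero_left, neg_zero]

end AlternatingArray

namespace CocycleArray

variable {P : ℤ → ℤ → ℤ → K} (hP : CocycleArray P)

include hP

/-- Base case of the induction on levels. At level `2` the recursion coming from `e_1` gives no
information on this value, so relations through level `5` are needed. The eight instances of the
cocycle condition form a linear system in the remaining values; the final coefficients eliminate all
of them but this one. -/
theorem neg_two_zero_two_eq_zero (h1 : ∀ m k, P 1 m k = 0) : P (-2) 0 2 = 0 := by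
  have h1' : ∀ n k, P n 1 k = 0 := fun n k => by rw [hP.swap_left, h1, neg_zero]
  have h1'' : ∀ n m, P n m 1 = 0 := fun n m => by rw [hP.swap_right, h1', neg_zero]
  have a1 := hP.cocycle (-3) (-1) 0 4
  have a2 := hP.cocycle (-4) (-1) 2 3
  have a3 := hP.cocycle (-3) (-2) 2 3
  have a4 := hP.cocycle (-2) (-1) 1 2
  have a5 := hP.cocycle (-3) (-2) 1 4
  have a6 := hP.cocycle (-3) (-1) 1 3
  have a7 := hP.cocycle (-3) 0 1 2
  have a8 := hP.cocycle (-4) (-1) 1 4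
  norm_num [h1, h1', h1'', hP.eq_zero_left, hP.eq_zero_right, hP.eq_zero_outer]
    at a1 a2 a3 a4 a5 a6 a7 a8
  rw [hP.swap_left (-3) (-1) 4, hP.rotate (-3) 0 3, hP.rotate (-3) (-1) 4] at a1
  rw [hP.rotate (-4) (-1) 5] at a2
  rw [hP.swap_left (-2) (-1) 3, hP.swap_left (-2) 0 2, hP.swap_left (-3) 0 3,
    hP.rotate (-3) (-2) 5] at a3
  rw [hP.swap_left (-2) 0 2, hP.rotate (-2) (-1) 3] at a4
  rw [hP.swap_left (-3) (-1) 4, hP.rotate (-3) (-2) 5] at a5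
  rw [hP.swap_left (-3) 0 3, hP.rotate (-3) (-1) 4] at a6
  rw [hP.rotate (-3) 0 3] at a7
  rw [hP.swap_left (-4) 0 4, hP.rotate (-4) (-1) 5] at a8
  linear_combination (-1 / 60) * a1 + (1 / 20) * a2 - (3 / 20) * a3 + (71 / 60) * a4
    + (1 / 20) * a5 + (1 / 30) * a6 - (37 / 60) * a7 - (1 / 60) * a8

/-- The values of a normalised array on the levels `N` and `-N`, given that it vanishes below. -/
theorem eq_zero_level (h1 : ∀ m k, P 1 m k = 0)
    (n : ℤ) (hn : 2 ≤ n) (hU : ∀ i j k : ℤ, |i| < n → |j| < n → |k| < n → P i j k = 0) :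
    (∀ k, 0 ≤ k → k ≤ n → P (-n) k (n - k) = 0) ∧ ∀ k, 0 ≤ k → k ≤ n → P n (-k) (k - n) = 0 := by
  have h1' : ∀ n k, P n 1 k = 0 := fun n k => by rw [hP.swap_left, h1, neg_zero]
  have h1'' : ∀ n m, P n m 1 = 0 := fun n m => by rw [hP.swap_right, h1', neg_zero]
  -- two negative indices
  have hT : ∀ k, 1 ≤ k → k ≤ n - 1 → P n (-k) (k - n) = 0 := by
    intro k hk hkn
    rcases eq_or_lt_of_le hn with rfl | hn3
    · obtain rfl : k = 1 := by omega
      exact hP.eq_zero_right _ _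
    -- Only the term with `[e_1, e_{n-1}] = (n - 2) e_n` survives: the others contain the index `1`
    -- or lie below level `n`.
    have e := hP.cocycle 1 (-k) (k - n) (n - 1)
    rw [show (1 : ℤ) + (n - 1) = n by ring, hU (1 + -k) (k - n) (n - 1),
      hU (1 + (k - n)) (-k) (n - 1)] at e
    · simp only [h1', mul_zero, sub_zero, add_zero, zero_add] at e
      have h0 : ((n - 1 : ℤ) : K) - (1 : ℤ) ≠ 0 := by
        rw [sub_ne_zero]; exact_mod_cast (by omega : n - 1 ≠ 1)
      exact (mul_eq_zero.mp e).resolve_left h0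
    all_goals rw [abs_lt]; constructor <;> omega
  -- Recursion for `w(k) = P (-n) k (n - k)`. The coefficient of `w(k + 1)` vanishes at `k = 1`, so
  -- `w(1) = 0` does not determine `w(2)`, which is treated separately in `hw2`.
  have hw : ∀ k, 0 ≤ k → k ≤ n - 1 →
      ((k : K) - 1) * P (-n) (k + 1) (n - (k + 1)) + ((n : K) - 2 - k) * P (-n) k (n - k) = 0 := by
    intro k hk hkn
    have e := hP.cocycle 1 (-n) k (n - 1 - k)
    rw [hU (1 + -n) k (n - 1 - k)] at e
    · simp only [h1'] at e
      rw [hP.swap_left (-n) (1 + k), hP.rotate (-n) k (1 + (n - 1 - k)),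
        show n - 1 - k = n - (k + 1) by ring, show 1 + (n - (k + 1)) = n - k by ring,
        add_comm 1 k] at e
      push_cast at e
      linear_combination e
    all_goals rw [abs_lt]; constructor <;> omega
  have hw2 : P (-n) 2 (n - 2) = 0 := by
    rcases eq_or_ne n 2 with rfl | hn2
    · rw [hP.swap_right, sub_self, hP.neg_two_zero_two_eq_zero h1, neg_zero]
    rcases eq_or_ne n 3 with rfl | hn3
    · exact h1'' _ _
    rcases eq_or_ne n 4 with rfl | hn4
    · exact hP.eq_zero_right _ _
    -- For `n ≥ 5` only `[e_{-2}, e_{2-n}]` and `[e_2, e_{n-2}]` reach level `n`; the latter is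
    -- killed by `hT`. The coefficient `4 - n` of the former is the reason for excluding `n = 4`.
    have e := hP.cocycle (-2) (2 - n) 2 (n - 2)
    rw [hU (-2 + 2), hU (-2 + (n - 2)), hU (2 - n + 2), hU (2 - n + (n - 2)),
      show -2 + (2 - n) = -n by ring, show 2 + (n - 2) = n by ring,
      hT 2 (by omega) (by omega)] at e
    · simp only [mul_zero, sub_zero, add_zero] at e
      exact (mul_eq_zero.mp e).resolve_left
        (sub_ne_zero.mpr (by exact_mod_cast (by omega : 2 - n ≠ -2)))
    all_goals rw [abs_lt]; constructor <;> omega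
  have hS : ∀ k, 0 ≤ k → k ≤ n → P (-n) k (n - k) = 0 := by
    intro k hk
    rcases eq_or_ne k 0 with rfl | hk0
    · intro _
      have e := hw 0 le_rfl (by omega)
      rw [zero_add, h1', mul_zero, zero_add] at e
      rcases eq_or_ne n 2 with rfl | hn2
      · rw [hP.swap_right, sub_zero, ← sub_self (2 : ℤ), hw2, neg_zero]
      rw [sub_sub] at e
      exact (mul_eq_zero.mp e).resolve_left
        (sub_ne_zero.mpr (by exact_mod_cast (by omega : n ≠ 2 + 0)))
    rcases eq_or_ne k 1 with rfl | hk1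
    · exact fun _ => h1' _ _
    have hk2 : 2 ≤ k := by omega
    clear hk hk0 hk1
    induction k, hk2 using Int.leInduction with
    | base => exact fun _ => hw2
    | succ k hk ih =>
      intro hkn
      have e := hw k (by omega) (by omega)
      rw [ih (by omega), mul_zero, add_zero] at e
      exact (mul_eq_zero.mp e).resolve_left
        (sub_ne_zero.mpr (by exact_mod_cast (by omega : k ≠ 1)))
  refine ⟨hS, fun k hk hkn => ?_⟩
  rcases eq_or_lt_of_le hk with rfl | hk0
  · rw [hP.swap_right, zero_sub, hP.swap_left, neg_zero, hP.swap_right]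
    have := hS 0 le_rfl (by omega)
    rw [sub_zero] at this
    simp [this]
  · rcases eq_or_lt_of_le hkn with rfl | hkn
    · rw [sub_self, hP.swap_left, hP.swap_right]
      have := hS 0 le_rfl (by omega)
      rw [sub_zero] at this
      simp [this]
    · exact hT k (by omega) (by omega)

/-- Induction on a bound for the absolute values of the indices. In a triple of sum zero, an index
of maximal absolute value has sign opposite to or zero against the other two, which is the shape
handled by `eq_zero_level`. -/
theorem eq_zero_of_normalized (hd : ∀ n m k, n + m + k ≠ 0 → P n m k = 0)
    (h1 : ∀ m k, P 1 m k = 0) (i j k : ℤ) : P i j k = 0 := by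
  have main : ∀ N : ℕ, ∀ i j k : ℤ, |i| < N → |j| < N → |k| < N → P i j k = 0 := by
    intro N
    induction N with
    | zero =>
      intro i j k hi
      exact absurd hi (by simp)
    | succ N ih =>
      have first : ∀ i j k : ℤ, i.natAbs = N → |j| < (N + 1 : ℕ) → |k| < (N + 1 : ℕ) →
          P i j k = 0 := by
        intro i j k hi hj hk
        by_cases hs : i + j + k = 0
        swap
        · exact hd _ _ _ hs
        rw [abs_lt] at hj hk
        push_cast at hj hk
        rcases lt_or_ge N 2 with hN | hN
        · have : i = 1 ∨ j = 1 ∨ k = 1 ∨ i = j := by omega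
          rcases this with rfl | rfl | rfl | rfl
          · exact h1 _ _
          · rw [hP.swap_left, h1, neg_zero]
          · rw [← hP.rotate, h1]
          · exact hP.eq_zero_left _ _
        obtain ⟨hS, hT⟩ := hP.eq_zero_level h1 N (by omega) ih
        rcases Int.natAbs_eq i with h | h
        · rw [hi] at h
          subst h
          have := hT (-j) (by omega) (by omega)
          rwa [neg_neg, show -j - (N : ℤ) = k by omega] at this
        · rw [hi] at h
          subst h
          have := hS j (by omega) (by omega)
          rwa [show (N : ℤ) - j = k by omega] at this
      intro i j k hi hj hk
      by_cases hi' : i.natAbs = N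
      · exact first i j k hi' hj hk
      by_cases hj' : j.natAbs = N
      · rw [hP.swap_left, first j i k hj' hi hk, neg_zero]
      by_cases hk' : k.natAbs = N
      · rw [← hP.rotate, first k i j hk' hi hj]
      · refine ih i j k ?_ ?_ ?_ <;> rw [Int.abs_eq_natAbs] at * <;> omega
  exact main (i.natAbs + j.natAbs + k.natAbs + 1) i j k (by rw [Int.abs_eq_natAbs]; omega)
    (by rw [Int.abs_eq_natAbs]; omega) (by rw [Int.abs_eq_natAbs]; omega)

end CocycleArray

end

end Witt

/-! ### Third cohomology of the Witt algebra and the Godbillon-Vey cocycle -/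

namespace Witt

open AlternatingMap ChevalleyEilenberg

section

variable {K : Type*} [Field K] [CharZero K]

/-- An alternating `2`-form on the Witt algebra with prescribed values on the basis. -/
theorem exists_twoForm (F : ℤ → ℤ → K) (hF : ∀ n m, F m n = -F n m) :
    ∃ φ : Witt K [⋀^Fin 2]→ₗ[K] K, ∀ n m, φ ![e K n, e K m] = F n m := by
  let B : Witt K →ₗ[K] Witt K →ₗ[K] K :=
    (basis K).constr K fun n => (basis K).constr K fun m => F n m
  have hB : ∀ n m, B (e K n) (e K m) = F n m := fun n m => by
    simp only [B, e, Module.Basis.constr_basis]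
  have hskew : B = -B.flip := by
    refine (basis K).ext fun n => (basis K).ext fun m => ?_
    change B (e K n) (e K m) = -B (e K m) (e K n)
    rw [hB, hB, hF]
  refine ⟨ofIsAlt B fun x => eq_zero_of_eq_neg (K := K) ?_, fun n m => ?_⟩
  · exact LinearMap.congr_fun (LinearMap.congr_fun hskew x) x
  · rw [ofIsAlt_apply, hB]

theorem threeForm_ext {f g : Witt K [⋀^Fin 3]→ₗ[K] K}
    (h : ∀ n m k, f ![e K n, e K m, e K k] = g ![e K n, e K m, e K k]) : f = g := by
  refine Module.Basis.ext_alternating (basis K) fun v _ => ?_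
  have hv : (fun i => basis K (v i)) = ![e K (v 0), e K (v 1), e K (v 2)] := by
    ext i; fin_cases i <;> rfl
  rw [hv, h]

theorem dTwo_e (φ : Witt K [⋀^Fin 2]→ₗ[K] K) (n m k : ℤ) :
    dTwo φ ![e K n, e K m, e K k] = ((m : K) - n) * φ ![e K (n + m), e K k]
      - ((k : K) - n) * φ ![e K (n + k), e K m] + ((k : K) - m) * φ ![e K (m + k), e K n] := by
  simp only [dTwo_apply, lie_e, map_pair_smul_left, smul_eq_mul]

theorem dTwo_e_one_zero_neg_one (φ : Witt K [⋀^Fin 2]→ₗ[K] K) :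
    dTwo φ ![e K 1, e K 0, e K (-1)] = 0 := by
  rw [dTwo_e]
  have h := map_pair_swap φ (e K 1) (e K (-1))
  norm_num [map_pair_self]
  rw [h]
  ring

theorem cocycleArray_of_isCocycleThree {f : Witt K [⋀^Fin 3]→ₗ[K] K} (hf : IsCocycleThree f) :
    CocycleArray fun n m k => f ![e K n, e K m, e K k] where
  swap_left n m k := map_triple_swap_left f _ _ _
  swap_right n m k := map_triple_swap_right f _ _ _
  cocycle i j k l := by
    simpa only [lie_e, map_triple_smul_left, smul_eq_mul] using hf (e K i) (e K j) (e K k) (e K l)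

/-- Cartan's formula for `e_0`: on a cocycle, `d ∘ ι_{e_0}` is the action of `e_0`, which up to sign
is multiplication by the degree. Dividing `ι_{e_0} f` by the degree gives a primitive outside degree
zero; in degree zero the division by `0` yields `0`, which plays no role. -/
theorem exists_dTwo_eq_of_ne_zero {f : Witt K [⋀^Fin 3]→ₗ[K] K} (hf : IsCocycleThree f) :
    ∃ φ : Witt K [⋀^Fin 2]→ₗ[K] K, ∀ n m k : ℤ, n + m + k ≠ 0 →
      f ![e K n, e K m, e K k] = dTwo φ ![e K n, e K m, e K k] := by
  obtain ⟨φ, hφ⟩ := exists_twoForm (K := K) (fun n m => f ![e K 0, e K n, e K m] / ((n : K) + m))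
    fun n m => by rw [map_triple_swap_right, add_comm, neg_div]
  refine ⟨φ, fun n m k h => ?_⟩
  have c := (cocycleArray_of_isCocycleThree hf).cocycle 0 n m k
  have h0 : (n : K) + m + k ≠ 0 := by exact_mod_cast h
  simp only [zero_add] at c
  rw [map_triple_swap_left f (e K n) (e K m), map_triple_rotate f (e K n) (e K m),
    map_triple_swap_left f (e K 0) (e K (n + m)), map_triple_swap_left f (e K 0) (e K (n + k)),
    map_triple_swap_left f (e K 0) (e K (m + k))] at c
  rw [dTwo_e, hφ, hφ, hφ]
  push_cast at c ⊢
  rw [show (n : K) + k + m = n + m + k by ring, show (m : K) + k + n = n + m + k by ring]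
  field_simp
  linear_combination c

/-- A degree-zero `2`-form is an odd function `a` through `φ(e_n, e_{-n}) = a(n)`. With `a(-1) = 0`,
the equation at `(e_1, e_j, e_{-1-j})` reads `(j - 1) a(j + 1) - (j + 2) a(j) = f(e_1, e_j,
e_{-1-j})`, which is solved recursively. No cocycle condition on `f` is needed. -/
theorem exists_dTwo_eq_one {f : Witt K [⋀^Fin 3]→ₗ[K] K}
    (h : f ![e K 1, e K 0, e K (-1)] = 0) :
    ∃ φ : Witt K [⋀^Fin 2]→ₗ[K] K,
      (∀ n m k : ℤ, n + m + k ≠ 0 → dTwo φ ![e K n, e K m, e K k] = 0) ∧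
      ∀ n m : ℤ, 1 + n + m = 0 →
        f ![e K 1, e K n, e K m] = dTwo φ ![e K 1, e K n, e K m] := by
  -- The division by `j - 1 = 0` at `j = 1` sets `b 2 = 0`; this is harmless, since the equation to
  -- be solved there has two equal arguments. The step `j = 0` gives `b 1 = 0` exactly because `f`
  -- vanishes at the `sl₂` triple.
  let b : ℕ → K := fun n => Nat.rec 0
    (fun j bj => (((j : K) + 2) * bj + f ![e K 1, e K (j : ℤ), e K (-1 - j)]) / ((j : K) - 1)) n
  have b0 : b 0 = 0 := rfl
  have bs : ∀ j : ℕ, b (j + 1) =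
      (((j : K) + 2) * b j + f ![e K 1, e K (j : ℤ), e K (-1 - j)]) / ((j : K) - 1) :=
    fun _ => rfl
  have b1 : b 1 = 0 := by
    simpa [b0, h] using bs 0
  let a : ℤ → K := fun n => (n.sign : K) * b n.natAbs
  have a1 : a (-1) = 0 := by simp [a, b1]
  have aneg : ∀ n, a (-n) = -a n := fun n => by simp [a]
  have anat : ∀ j : ℕ, a j = b j := by
    rintro (_ | j)
    · simp [a, b0]
    · simp only [a, Int.natAbs_natCast]
      rw [Int.sign_eq_one_of_pos (by omega), Int.cast_one, one_mul]
  obtain ⟨φ, hφ⟩ := exists_twoForm (K := K) (fun n m => if n + m = 0 then a n else 0) (by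
    intro n m
    rw [add_comm]
    split_ifs with h
    · rw [show m = -n by omega, aneg]
    · rw [neg_zero])
  refine ⟨φ, ?_, ?_⟩
  · intro n m k h
    rw [dTwo_e, hφ, hφ, hφ, if_neg h, if_neg (by omega), if_neg (by omega)]
    ring
  · have key : ∀ j : ℕ,
        f ![e K 1, e K (j : ℤ), e K (-1 - j)] = dTwo φ ![e K 1, e K (j : ℤ), e K (-1 - j)] := by
      intro j
      by_cases hj : j = 1
      · subst hj
        rw [Nat.cast_one, map_triple_eq_zero_left, map_triple_eq_zero_left]
      have hj' : (j : K) - 1 ≠ 0 := sub_ne_zero.mpr (by exact_mod_cast hj)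
      rw [dTwo_e, hφ, hφ, hφ, if_pos (by ring), if_pos (by ring), if_pos (by ring),
        show 1 + (j : ℤ) = (j + 1 : ℕ) by push_cast; ring,
        show 1 + (-1 - (j : ℤ)) = -j by ring, show (j : ℤ) + (-1 - j) = -1 by ring, a1, aneg,
        anat, anat, bs]
      push_cast
      field_simp
      ring
    intro n m hnm
    rcases le_or_gt 0 n with hn | hn
    · obtain ⟨j, rfl⟩ := Int.eq_ofNat_of_zero_le hn
      obtain rfl : m = -1 - j := by omega
      exact key j
    · obtain ⟨j, rfl⟩ := Int.eq_ofNat_of_zero_le (show 0 ≤ m by omega)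
      obtain rfl : n = -1 - j := by omega
      -- As `n + m = -1`, exactly one of `n`, `m` is nonnegative, so exchanging them reduces to
      -- `key`.
      rw [map_triple_swap_right f, map_triple_swap_right (dTwo φ), key j]

/-- A `3`-cocycle of the Witt algebra that vanishes at `(e_1, e_0, e_{-1})` is a coboundary. -/
theorem exists_eq_dTwo {f : Witt K [⋀^Fin 3]→ₗ[K] K} (hf : IsCocycleThree f)
    (h : f ![e K 1, e K 0, e K (-1)] = 0) : ∃ φ, f = dTwo φ := by
  obtain ⟨φ, hφ⟩ := exists_dTwo_eq_of_ne_zero hf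
  have h' : (f - dTwo φ) ![e K 1, e K 0, e K (-1)] = 0 := by
    rw [AlternatingMap.sub_apply, h, dTwo_e_one_zero_neg_one, sub_zero]
  obtain ⟨χ, hχ, hχ1⟩ := exists_dTwo_eq_one h'
  have hd : ∀ n m k : ℤ, n + m + k ≠ 0 →
      (f - dTwo φ - dTwo χ) ![e K n, e K m, e K k] = 0 := fun n m k hnmk => by
    rw [AlternatingMap.sub_apply, AlternatingMap.sub_apply, hχ _ _ _ hnmk, hφ _ _ _ hnmk,
      sub_self, sub_zero]
  have hg : IsCocycleThree (f - dTwo φ - dTwo χ) :=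
    (hf.sub (isCocycleThree_dTwo φ)).sub (isCocycleThree_dTwo χ)
  have hz : f - dTwo φ - dTwo χ = 0 := by
    refine threeForm_ext fun n m k => ?_
    refine (cocycleArray_of_isCocycleThree hg).eq_zero_of_normalized hd (fun m k => ?_) n m k
    by_cases hmk : 1 + m + k = 0
    · rw [AlternatingMap.sub_apply, hχ1 _ _ hmk, sub_self]
    · exact hd _ _ _ hmk
  refine ⟨φ + χ, ?_⟩
  rw [dTwo_add, ← sub_eq_zero, ← sub_sub, hz]

/-- The coboundary is itself alternating and multilinear, so the cocycle condition may be tested on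
basis vectors. -/
theorem isCocycleThree_of_cocycleArray {f : Witt K [⋀^Fin 3]→ₗ[K] K}
    (h : CocycleArray fun n m k => f ![e K n, e K m, e K k]) : IsCocycleThree f := by
  let E := TrivialLieModule.equiv K (Witt K) K
  let ψ : Cochain K (Witt K) (Trivial K (Witt K)) 3 := E.symm.toLinearMap.compAlternatingMap f
  refine (isCocycleThree_iff ψ).mpr (LinearMap.mem_ker.mpr ?_)
  refine Module.Basis.ext_alternating (basis K) fun v _ => E.injective ?_
  have hv : (fun i => basis K (v i)) = ![e K (v 0), e K (v 1), e K (v 2), e K (v 3)] := by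
    ext i; fin_cases i <;> rfl
  rw [hv, coboundary_three_apply]
  simp only [lie_e, map_triple_smul_left]
  exact h.cocycle (v 0) (v 1) (v 2) (v 3)

/-- The Godbillon-Vey form `(f, g, h) ↦ ∫ det (u, u', u'')`, where `u = (f, g, h)` are regarded
as Laurent polynomials and `'` is the derivation `T d/dT`. -/
theorem exists_vandermonde_form : ∃ f : Witt K [⋀^Fin 3]→ₗ[K] K, ∀ n m k : ℤ,
    f ![e K n, e K m, e K k] =
      if n + m + k = 0 then ((m : K) - n) * ((k : K) - n) * ((k : K) - m) else 0 := by
  -- Under `e_n ↦ T^n`, `D i` is the `i`-th power of `T d/dT`. On basis vectors the determinant is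
  -- thus a Vandermonde determinant in `n, m, k` times `T^(n+m+k)`, and the integral is the
  -- coefficient of `T^0`.
  let D : Fin 3 → Witt K →ₗ[K] LaurentPolynomial K := fun i =>
    (basis K).constr K fun n => LaurentPolynomial.C ((n : K) ^ (i : ℕ)) * LaurentPolynomial.T n
  have hD : ∀ i n, D i (e K n) =
      LaurentPolynomial.C ((n : K) ^ (i : ℕ)) * LaurentPolynomial.T n := fun i n => by
    simp only [D, e, Module.Basis.constr_basis]
  let d := Matrix.detRowAlternating (n := Fin 3) (R := LaurentPolynomial K)
  let dK : (Fin 3 → LaurentPolynomial K) [⋀^Fin 3]→ₗ[K] LaurentPolynomial K :=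
    { d.toMultilinearMap.restrictScalars K with map_eq_zero_of_eq' := d.map_eq_zero_of_eq' }
  let coeff : LaurentPolynomial K →ₗ[K] K :=
    { toFun := fun p => p.coeff 0, map_add' := fun _ _ => rfl, map_smul' := fun _ _ => rfl }
  refine ⟨coeff.compAlternatingMap (dK.compLinearMap (LinearMap.pi D)), fun n m k => ?_⟩
  have hdet : (dK.compLinearMap (LinearMap.pi D)) ![e K n, e K m, e K k] =
      LaurentPolynomial.C (((m : K) - n) * ((k : K) - n) * ((k : K) - m)) *
        LaurentPolynomial.T (n + m + k) := by
    change Matrix.det (Matrix.of fun i j => D j (![e K n, e K m, e K k] i)) = _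
    rw [Matrix.det_fin_three, LaurentPolynomial.T_add, LaurentPolynomial.T_add]
    simp only [Matrix.of_apply, Matrix.cons_val, hD, map_mul, map_sub, map_pow, map_one,
      Fin.val_zero, Fin.val_one, Fin.val_two, pow_zero, pow_one]
    ring
  rw [LinearMap.compAlternatingMap_apply, hdet]
  rw [← LaurentPolynomial.single_eq_C_mul_T]
  exact Finsupp.single_apply

theorem exists_godbillonVey (A : K) : ∃ f : Witt K [⋀^Fin 3]→ₗ[K] K, IsCocycleThree f ∧
    ∀ n m k : ℤ, f ![e K n, e K m, e K k] =
      if k = -(n + m) then A * (m - n) * (2 * m + n) * (m + 2 * n) else 0 := by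
  obtain ⟨g, hg⟩ := exists_vandermonde_form (K := K)
  have hc : IsCocycleThree g := by
    refine isCocycleThree_of_cocycleArray
      ⟨⟨fun _ _ _ => map_triple_swap_left g _ _ _, fun _ _ _ => map_triple_swap_right g _ _ _⟩,
        ?_⟩
    intro i j k l
    simp only [hg]
    by_cases h : i + j + k + l = 0
    · obtain rfl : l = -(i + j + k) := by omega
      rw [if_pos (by ring), if_pos (by ring), if_pos (by ring), if_pos (by ring),
        if_pos (by ring), if_pos (by ring)]
      push_cast
      ring
    · rw [if_neg (by omega), if_neg (by omega), if_neg (by omega), if_neg (by omega),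
        if_neg (by omega), if_neg (by omega)]
      ring
  refine ⟨A • g, hc.smul A, fun n m k => ?_⟩
  rw [AlternatingMap.smul_apply, hg]
  by_cases h : n + m + k = 0
  · obtain rfl : k = -(n + m) := by omega
    rw [if_pos h, if_pos rfl, smul_eq_mul]
    push_cast
    ring
  · rw [if_neg h, if_neg (by omega), smul_zero]

end

end Witt

/-! ### The cup square of the cubic cocycle -/

namespace Virasoro

section

variable {K : Type*} [Field K] [CharZero K]

/-- The product of two values of the cubic `2`-cocycle of the Witt algebra. -/
def cubicProduct (K : Type*) [Field K] (i j k l : ℤ) : K :=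
  if i + j = 0 ∧ k + l = 0 then ((i : K) ^ 3 - i) * ((k : K) ^ 3 - k) else 0

/-- The cup square of the cubic `2`-cocycle is not a coboundary on the Witt algebra. -/
theorem eq_zero_of_cup_square {P : ℤ → ℤ → ℤ → K} (hP : Witt.AlternatingArray P) (c : K)
    (h : ∀ i j k l : ℤ,
      ((j : K) - i) * P (i + j) k l - ((k : K) - i) * P (i + k) j l + ((l : K) - i) * P (i + l) j k
        + ((k : K) - j) * P (j + k) i l - ((l : K) - j) * P (j + l) i k
        + ((l : K) - k) * P (k + l) i j =
      c * (cubicProduct K i j k l - cubicProduct K i k j l + cubicProduct K i l j k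
        + cubicProduct K j k i l - cubicProduct K j l i k + cubicProduct K k l i j)) :
    c = 0 := by
  -- A finite certificate of non-exactness: these instances involve only indices of absolute value
  -- at most `7`. In the combination at the end all values of `P` cancel, while the cubic terms add
  -- up to `c`.
  have a1 := h (-5) (-1) 2 4
  have a2 := h (-4) (-2) 2 4
  have a3 := h (-3) (-1) 0 4
  have a4 := h (-2) (-1) 1 2
  have a5 := h (-3) (-2) 1 4
  have a6 := h (-3) (-2) 2 3
  have a7 := h (-6) 1 2 3
  have a8 := h (-3) (-1) 1 3
  have a9 := h (-4) (-3) 1 6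
  have a10 := h (-6) (-1) 1 6
  have a11 := h (-5) (-1) 0 6
  have a12 := h (-7) 0 1 6
  have a13 := h (-5) (-2) 0 7
  have a14 := h (-6) (-1) 3 4
  have a15 := h (-4) (-3) 3 4
  have a16 := h (-5) (-2) 1 6
  have a17 := h (-5) (-2) 3 4
  norm_num [cubicProduct, hP.eq_zero_left, hP.eq_zero_right, hP.eq_zero_outer]
    at a1 a2 a3 a4 a5 a6 a7 a8 a9 a10 a11 a12 a13 a14 a15 a16 a17
  rw [hP.swap_left (-5) 1 4, hP.rotate (-5) 2 3, hP.rotate (-5) (-1) 6] at a1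
  rw [hP.swap_left (-2) 0 2, hP.swap_left (-4) 0 4, hP.rotate (-4) (-2) 6] at a2
  rw [hP.rotate (-1) 0 1, hP.swap_left (-3) (-1) 4, hP.rotate (-3) 0 3,
    hP.rotate (-3) (-1) 4] at a3
  rw [hP.swap_left (-1) 0 1, hP.swap_left (-2) 0 2, hP.rotate (-2) (-1) 3] at a4
  rw [hP.swap_left (-3) (-1) 4, hP.rotate (-3) 1 2, hP.rotate (-3) (-2) 5] at a5
  rw [hP.swap_left (-2) (-1) 3, hP.swap_left (-2) 0 2, hP.swap_left (-3) 0 3,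
    hP.swap_left (-3) 1 2, hP.rotate (-3) (-2) 5] at a6
  rw [hP.rotate (-6) 2 4, hP.rotate (-6) 1 5] at a7
  rw [hP.swap_left (-1) 0 1, hP.swap_left (-3) 0 3, hP.rotate (-3) 1 2,
    hP.rotate (-3) (-1) 4] at a8
  rw [hP.rotate (-3) 1 2, hP.swap_left (-4) (-2) 6, hP.rotate (-4) 1 3,
    hP.rotate (-4) (-3) 7] at a9
  rw [hP.swap_left (-1) 0 1, hP.swap_left (-6) 0 6, hP.rotate (-6) 1 5,
    hP.rotate (-6) (-1) 7] at a10
  rw [hP.rotate (-1) 0 1, hP.swap_left (-5) (-1) 6, hP.rotate (-5) 0 5,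
    hP.rotate (-5) (-1) 6] at a11
  rw [hP.swap_left (-7) 1 6, hP.rotate (-7) 1 6, hP.rotate (-7) 0 7] at a12
  rw [hP.rotate (-2) 0 2, hP.swap_left (-5) (-2) 7, hP.rotate (-5) 0 5,
    hP.rotate (-5) (-2) 7] at a13
  rw [hP.swap_left (-6) 2 4, hP.rotate (-6) (-1) 7] at a14
  rw [hP.swap_left (-3) (-1) 4, hP.swap_left (-3) 0 3, hP.swap_left (-4) 0 4,
    hP.swap_left (-4) 1 3, hP.rotate (-4) (-3) 7] at a15
  rw [hP.swap_left (-5) (-1) 6, hP.rotate (-5) 1 4, hP.rotate (-5) (-2) 7] at a16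
  rw [hP.swap_left (-2) (-1) 3, hP.swap_left (-5) 1 4, hP.swap_left (-5) 2 3,
    hP.rotate (-5) (-2) 7] at a17
  linear_combination -(1 / 10098) * a1 + (25 / 80784) * a2 - (25 / 20196) * a3 - (233 / 40392) * a4
    - (157 / 242352) * a5 + (157 / 80784) * a6 - (7 / 26928) * a7 + (1 / 594) * a8
    + (5 / 40392) * a9 - (1 / 26928) * a10 - (5 / 17952) * a11 - (7 / 53856) * a12 + (35 / 161568) * a13
    + (5 / 26928) * a14 - (25 / 40392) * a15 + (5 / 242352) * a16 - (25 / 242352) * a17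

end

end Virasoro

/-! ### Second cohomology of the Witt algebra -/

namespace Witt

section

variable {K : Type*} [Field K] [CharZero K]

/-- The scalar `2`-cocycles of the Witt algebra are spanned by the coboundaries and the cubic
cocycle. -/
theorem exists_eq_of_twoCocycle {b : ℤ → ℤ → K} (hs : ∀ n m, b m n = -b n m)
    (hc : ∀ n m k : ℤ, ((m : K) - n) * b (n + m) k - ((k : K) - n) * b (n + k) m
      + ((k : K) - m) * b (m + k) n = 0) :
    ∃ (l : ℤ → K) (a : K), ∀ n m : ℤ,
      b n m = ((m : K) - n) * l (n + m) + if n + m = 0 then a * ((n : K) ^ 3 - n) else 0 := by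
  have hself : ∀ n, b n n = 0 := fun n => eq_zero_of_eq_neg (K := K) (hs n n)
  -- In degree zero, `b 1 (-1)` and `b 2 (-2)` determine everything: the recursion for `b n (-n)`
  -- has leading coefficient `n - 1`, so it starts at `n = 2`. The value of `a` fits `n = 2`, where
  -- `n³ - n = 6`.
  let a : K := (b 2 (-2) - 2 * b 1 (-1)) / 6
  have hnat : ∀ n : ℕ, b n (-n) = a * ((n : K) ^ 3 - n) + n * b 1 (-1) := by
    intro n
    rcases lt_or_ge n 2 with hn | hn
    · interval_cases n
      · simp [hself]
      · simp
    induction n, hn using Nat.le_induction with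
    | base =>
      push_cast
      simp only [a]
      ring
    | succ n hn ih =>
      have c := hc 1 n (-1 - n)
      rw [show 1 + (-1 - (n : ℤ)) = -n by ring, show (n : ℤ) + (-1 - n) = -1 by ring,
        hs n (-n), hs 1 (-1), ih, show 1 + (n : ℤ) = n + 1 by ring,
        show -1 - (n : ℤ) = -(n + 1) by ring] at c
      have hn1 : (n : K) - 1 ≠ 0 := sub_ne_zero.mpr (by exact_mod_cast (by omega : n ≠ 1))
      push_cast at c ⊢
      apply mul_left_cancel₀ hn1
      linear_combination c
  have hint : ∀ n : ℤ, b n (-n) = a * ((n : K) ^ 3 - n) + n * b 1 (-1) := by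
    intro n
    rcases Int.eq_nat_or_neg n with ⟨j, rfl | rfl⟩
    · exact_mod_cast hnat j
    · rw [neg_neg, hs, hnat]
      push_cast
      ring
  -- Outside degree zero the primitive is the contraction with `e_0` divided by the degree; in
  -- degree zero, `-2n · l(0)` has to match the linear part `n · b 1 (-1)`.
  refine ⟨fun n => if n = 0 then -b 1 (-1) / 2 else b 0 n / n, a, fun n m => ?_⟩
  by_cases h : n + m = 0
  · obtain rfl : m = -n := by omega
    rw [if_pos h, hint]
    simp only [add_neg_cancel, if_true]
    push_cast
    ring
  · have c := hc 0 n m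
    have h0 : (n : K) + m ≠ 0 := by exact_mod_cast h
    simp only [if_neg h]
    rw [zero_add, zero_add, hs n m, hs 0 (n + m)] at c
    push_cast at c ⊢
    field_simp
    linear_combination c

end

end Witt

/-! ### Third cohomology of the Virasoro algebra -/

namespace Virasoro

open AlternatingMap ChevalleyEilenberg

section

variable {K : Type*} [Field K] [CharZero K]

variable (K) in
/-- The projection of the Virasoro algebra onto the Witt algebra. -/
def toWitt : Virasoro K →ₗ[K] Witt K where
  toFun x := x.2
  map_add' _ _ := rfl
  map_smul' _ _ := rfl

variable (K) in
/-- The linear embedding of the Witt algebra into the Virasoro algebra. -/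
def ofWitt : Witt K →ₗ[K] Virasoro K where
  toFun w := ((0 : K), w)
  map_add' _ _ := Prod.ext (add_zero (0 : K)).symm rfl
  map_smul' c _ := Prod.ext (mul_zero c).symm rfl

variable (K) in
/-- The central coordinate of the Virasoro algebra. -/
def centralCoord : Virasoro K →ₗ[K] K where
  toFun x := x.1
  map_add' _ _ := rfl
  map_smul' _ _ := rfl

theorem toWitt_lie (x y : Virasoro K) : toWitt K ⁅x, y⁆ = ⁅toWitt K x, toWitt K y⁆ := rfl

theorem t_lie (x : Virasoro K) : ⁅t K, x⁆ = 0 := by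
  rw [← lie_skew, lie_t, neg_zero]

theorem eq_smul_t_add (x : Virasoro K) : x = centralCoord K x • t K + ofWitt K (toWitt K x) :=
  Prod.ext (by change x.1 = x.1 * 1 + 0; ring)
    (by change x.2 = x.1 • (0 : Witt K) + x.2; rw [smul_zero, zero_add])

theorem isCocycleThree_pullback {f : Witt K [⋀^Fin 3]→ₗ[K] K} (hf : IsCocycleThree f) :
    IsCocycleThree (f.compLinearMap (toWitt K)) := by
  intro x y z w
  simp only [compLinearMap_triple, toWitt_lie]
  exact hf _ _ _ _

theorem dTwo_pullback (φ : Witt K [⋀^Fin 2]→ₗ[K] K) :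
    dTwo (φ.compLinearMap (toWitt K)) = (dTwo φ).compLinearMap (toWitt K) := by
  ext v
  have hv : v = ![v 0, v 1, v 2] := by ext i; fin_cases i <;> rfl
  rw [hv]
  simp only [compLinearMap_triple, dTwo_apply, compLinearMap_pair, toWitt_lie]

theorem threeForm_lie_e (f : Virasoro K [⋀^Fin 3]→ₗ[K] K) (n m : ℤ) (x y : Virasoro K) :
    f ![⁅e K n, e K m⁆, x, y] = ((m : K) - n) * f ![e K (n + m), x, y]
      - (1 / 12 : K) * ((n : K) ^ 3 - n) * (if n = -m then 1 else 0) * f ![t K, x, y] := by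
  rw [lie_e, sub_eq_add_neg, ← neg_smul, map_triple_add_left, map_triple_smul_left,
    map_triple_smul_left, smul_eq_mul, smul_eq_mul]
  ring

theorem dTwo_e_one_zero_neg_one (φ : Virasoro K [⋀^Fin 2]→ₗ[K] K) :
    dTwo φ ![e K 1, e K 0, e K (-1)] = 0 := by
  have h := map_pair_swap φ (e K 1) (e K (-1))
  have neg_left : ∀ x y, φ ![-x, y] = -φ ![x, y] := fun x y => by
    rw [← neg_one_smul K, map_pair_smul_left, neg_one_smul]
  rw [dTwo_apply, lie_e, lie_e, lie_e]
  norm_num [neg_left, map_pair_self, map_pair_smul_left, two_smul, map_pair_add_left]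
  rw [h]
  ring

/-- A `3`-form that vanishes when one argument is central is pulled back from the Witt algebra. -/
theorem eq_pullback {f : Virasoro K [⋀^Fin 3]→ₗ[K] K} (h : ∀ x y, f ![t K, x, y] = 0) :
    f = (f.compLinearMap (ofWitt K)).compLinearMap (toWitt K) := by
  have left : ∀ x y z, f ![x, y, z] = f ![ofWitt K (toWitt K x), y, z] := fun x y z => by
    conv_lhs => rw [eq_smul_t_add x]
    rw [map_triple_add_left, map_triple_smul_left, h, smul_zero, zero_add]
  ext v
  have hv : v = ![v 0, v 1, v 2] := by ext i; fin_cases i <;> rfl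
  rw [hv, compLinearMap_triple, compLinearMap_triple, left, ← map_triple_rotate, left,
    ← map_triple_rotate, left, ← map_triple_rotate]

/-- Up to coboundaries, the contraction of a `3`-cocycle with `t` is a multiple of the cubic
cocycle. -/
theorem exists_contraction_eq {f : Virasoro K [⋀^Fin 3]→ₗ[K] K} (hf : IsCocycleThree f) :
    ∃ (φ : Virasoro K [⋀^Fin 2]→ₗ[K] K) (a : K), ∀ n m : ℤ,
      (f - dTwo φ) ![t K, e K n, e K m] = if n + m = 0 then a * ((n : K) ^ 3 - n) else 0 := by
  -- With `t` as first argument, centrality removes the brackets with `t`, and the central parts of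
  -- the other brackets give `f(t, t, ·) = 0`. What remains is the `2`-cocycle condition for the
  -- Witt bracket.
  obtain ⟨l, a, hl⟩ := Witt.exists_eq_of_twoCocycle (K := K)
    (b := fun n m => f ![t K, e K n, e K m]) (fun n m => map_triple_swap_right f _ _ _) (by
      intro n m k
      have c := hf (t K) (e K n) (e K m) (e K k)
      have z : ∀ x y, f ![0, x, y] = 0 := fun x y =>
        f.map_coord_zero (m := ![0, x, y]) 0 rfl
      simp only [t_lie, z, threeForm_lie_e, map_triple_eq_zero_left, mul_zero, sub_zero] at c
      simp only [map_triple_swap_left f (t K)] at c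
      linear_combination -c)
  let lam : Witt K →ₗ[K] K := (Witt.basis K).constr K l
  have hlam : ∀ n, lam (Witt.e K n) = l n := fun n => by
    simp only [lam, Witt.e, Module.Basis.constr_basis]
  -- The form `λ ∧ t*`, with `t*` the central coordinate and `λ` the functional given by `l`. The
  -- contraction of its coboundary with `t` is `λ([x, y])`, the exact part of the `2`-cocycle.
  let B : Virasoro K →ₗ[K] Virasoro K →ₗ[K] K :=
    (LinearMap.mul K K).compl₁₂ (lam ∘ₗ toWitt K) (centralCoord K) -
      (LinearMap.mul K K).compl₁₂ (centralCoord K) (lam ∘ₗ toWitt K)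
  have hB : ∀ x y, B x y = lam (toWitt K x) * centralCoord K y -
      centralCoord K x * lam (toWitt K y) := fun _ _ => rfl
  let φ := ofIsAlt B fun x => by rw [hB, mul_comm, sub_self]
  refine ⟨φ, a, fun n m => ?_⟩
  have hφ : dTwo φ ![t K, e K n, e K m] = ((m : K) - n) * l (n + m) := by
    rw [dTwo_apply, t_lie, t_lie]
    have h0 : ∀ x, φ ![0, x] = 0 := fun x => φ.map_coord_zero (m := ![0, x]) 0 rfl
    rw [h0, h0, sub_zero, zero_add, ofIsAlt_apply, hB, toWitt_lie]
    change lam ⁅Witt.e K n, Witt.e K m⁆ * 1 - _ * lam 0 = _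
    rw [Witt.lie_e, map_smul, hlam, _root_.map_zero, mul_zero, sub_zero, mul_one, smul_eq_mul]
  rw [AlternatingMap.sub_apply, hφ, hl]
  ring

/-- On the `ê_n`, the central parts of the brackets contribute products of `ω` with `ι_t f = a ω`,
where `ω` is the cubic cocycle. The cocycle condition thus exhibits `a / 12` times the cup square of
`ω` as exact on the Witt algebra, which forces `a = 0`. -/
theorem contraction_eq_zero {f : Virasoro K [⋀^Fin 3]→ₗ[K] K} (hf : IsCocycleThree f) {a : K}
    (h : ∀ n m : ℤ, f ![t K, e K n, e K m] = if n + m = 0 then a * ((n : K) ^ 3 - n) else 0)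
    (x y : Virasoro K) : f ![t K, x, y] = 0 := by
  have ha : (1 / 12 : K) * a = 0 := by
    refine eq_zero_of_cup_square (P := fun n m k => f ![e K n, e K m, e K k])
      ⟨fun _ _ _ => map_triple_swap_left f _ _ _, fun _ _ _ => map_triple_swap_right f _ _ _⟩ _
      fun i j k l => ?_
    have key : ∀ i j k l : ℤ, f ![⁅e K i, e K j⁆, e K k, e K l] =
        ((j : K) - i) * f ![e K (i + j), e K k, e K l] - 1 / 12 * a * cubicProduct K i j k l := by
      intro i j k l
      rw [threeForm_lie_e, h, cubicProduct]
      by_cases hij : i + j = 0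
      · by_cases hkl : k + l = 0
        · rw [if_pos (by omega), if_pos hkl, if_pos ⟨hij, hkl⟩]
          ring
        · simp only [hkl, and_false, if_false, mul_zero]
      · simp only [hij, false_and, if_false, mul_zero, if_neg (show i ≠ -j by omega), zero_mul]
    have c := hf (e K i) (e K j) (e K k) (e K l)
    simp only [key] at c
    linear_combination c
  have ha' : a = 0 := (mul_eq_zero.mp ha).resolve_left (by norm_num)
  have hz : ((f.curryLeft (t K)).compLinearMap (ofWitt K)) = 0 := by
    refine Module.Basis.ext_alternating (Witt.basis K) fun v _ => ?_
    have hv : (fun i => Witt.basis K (v i)) = ![Witt.e K (v 0), Witt.e K (v 1)] := by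
      ext i; fin_cases i <;> rfl
    rw [hv, compLinearMap_pair]
    refine (h (v 0) (v 1)).trans ?_
    simp [ha']
  have left : ∀ x y, f ![t K, x, y] = f ![t K, ofWitt K (toWitt K x), y] := fun x y => by
    conv_lhs => rw [eq_smul_t_add x]
    rw [map_triple_swap_left, map_triple_add_left, map_triple_smul_left, map_triple_eq_zero_left,
      smul_zero, zero_add, map_triple_swap_left, neg_neg]
  rw [left, map_triple_swap_right, left, map_triple_swap_right, neg_neg]
  exact (compLinearMap_pair (f.curryLeft (t K)) (ofWitt K) _ _).symm.trans
    (congrArg (fun g => g ![toWitt K x, toWitt K y]) hz)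

/-- `ofWitt` is not a Lie homomorphism, but it is a linear section of the Lie homomorphism `toWitt`,
and this suffices. -/
theorem isCocycleThree_of_pullback {f : Witt K [⋀^Fin 3]→ₗ[K] K}
    (hf : IsCocycleThree (f.compLinearMap (toWitt K))) : IsCocycleThree f := by
  intro x y z w
  have c := hf (ofWitt K x) (ofWitt K y) (ofWitt K z) (ofWitt K w)
  simp only [compLinearMap_triple, toWitt_lie] at c
  exact c

/-- A `3`-cocycle of the Virasoro algebra that vanishes at `(ê_1, ê_0, ê_{-1})` is a
coboundary. -/
theorem exists_eq_dTwo {f : Virasoro K [⋀^Fin 3]→ₗ[K] K} (hf : IsCocycleThree f)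
    (h : f ![e K 1, e K 0, e K (-1)] = 0) : ∃ φ, f = dTwo φ := by
  obtain ⟨φ, a, hφ⟩ := exists_contraction_eq hf
  have hg : IsCocycleThree (f - dTwo φ) := hf.sub (isCocycleThree_dTwo φ)
  have hp := eq_pullback (contraction_eq_zero hg hφ)
  rw [hp] at hg
  -- Subtracting `dTwo φ` has not changed the value at the `sl₂` triple, so the form induced on the
  -- Witt algebra still vanishes there.
  obtain ⟨χ, hχ⟩ := Witt.exists_eq_dTwo (isCocycleThree_of_pullback hg) (by
    rw [compLinearMap_triple]
    change (f - dTwo φ) ![e K 1, e K 0, e K (-1)] = 0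
    rw [AlternatingMap.sub_apply, h, dTwo_e_one_zero_neg_one, sub_zero])
  rw [hχ, ← dTwo_pullback] at hp
  refine ⟨χ.compLinearMap (toWitt K) + φ, ?_⟩
  rw [dTwo_add, ← hp, sub_add_cancel]

end

end Virasoro

/-! ### The main theorem -/

theorem theorem5p2p1 (K : Type*) [Field K] [CharZero K] :
    -- `dim H³(W, K) = dim H³(V, K) = 1`
    Module.rank K (ChevalleyEilenberg.Cohomology K (Witt K) (ChevalleyEilenberg.Trivial K (Witt K)) 3) = 1 ∧
    Module.rank K (ChevalleyEilenberg.Cohomology K (Virasoro K) (ChevalleyEilenberg.Trivial K (Virasoro K)) 3) = 1 ∧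
    -- the Godbillon-Vey cocycle on `W`
    (∀ A : K, A ≠ 0 →
      ∃ GV ∈ ChevalleyEilenberg.cocycles K (Witt K) (ChevalleyEilenberg.Trivial K (Witt K)) 3,
        (∀ n m k : ℤ,
          TrivialLieModule.equiv K (Witt K) K (GV ![Witt.e K n, Witt.e K m, Witt.e K k]) =
            if k = -(n + m) then A * (m - n) * (2 * m + n) * (m + 2 * n) else 0) ∧
        GV ![Witt.e K 1, Witt.e K 0, Witt.e K (-1)] ≠ 0) ∧
    (∀ ψ ∈ ChevalleyEilenberg.coboundaries K (Witt K) (ChevalleyEilenberg.Trivial K (Witt K)) 3,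
      ψ ![Witt.e K 1, Witt.e K 0, Witt.e K (-1)] = 0) ∧
    -- the Godbillon-Vey cocycle on `V`
    (∀ A : K, A ≠ 0 →
      ∃ GV ∈ ChevalleyEilenberg.cocycles K (Virasoro K) (ChevalleyEilenberg.Trivial K (Virasoro K)) 3,
        (∀ n m k : ℤ,
          TrivialLieModule.equiv K (Virasoro K) K
              (GV ![Virasoro.e K n, Virasoro.e K m, Virasoro.e K k]) =
            if k = -(n + m) then A * (m - n) * (2 * m + n) * (m + 2 * n) else 0) ∧
        (∀ n m : ℤ, GV ![Virasoro.e K n, Virasoro.e K m, Virasoro.t K] = 0) ∧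
        GV ![Virasoro.e K 1, Virasoro.e K 0, Virasoro.e K (-1)] ≠ 0) ∧
    (∀ ψ ∈ ChevalleyEilenberg.coboundaries K (Virasoro K) (ChevalleyEilenberg.Trivial K (Virasoro K)) 3,
      ψ ![Virasoro.e K 1, Virasoro.e K 0, Virasoro.e K (-1)] = 0) := by
  obtain ⟨g, hg, hgv⟩ := Witt.exists_godbillonVey (1 : K)
  have pull : ∀ (f : Witt K [⋀^Fin 3]→ₗ[K] K) (n m k : ℤ),
      f.compLinearMap (Virasoro.toWitt K) ![Virasoro.e K n, Virasoro.e K m, Virasoro.e K k] =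
        f ![Witt.e K n, Witt.e K m, Witt.e K k] := fun f n m k =>
    AlternatingMap.compLinearMap_triple f (Virasoro.toWitt K) _ _ _
  have nonzero : ∀ (f : Witt K [⋀^Fin 3]→ₗ[K] K) (A : K), A ≠ 0 →
      (∀ n m k : ℤ, f ![Witt.e K n, Witt.e K m, Witt.e K k] =
        if k = -(n + m) then A * (m - n) * (2 * m + n) * (m + 2 * n) else 0) →
      f ![Witt.e K 1, Witt.e K 0, Witt.e K (-1)] ≠ 0 := by
    intro f A hA hf
    rw [hf]
    norm_num [hA]
  have hg0 := nonzero g 1 one_ne_zero hgv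
  refine ⟨?_, ?_, fun A hA => ?_, fun ψ hψ => ?_, fun A hA => ?_, fun ψ hψ => ?_⟩
  · exact ChevalleyEilenberg.rank_cohomology_three_eq_one _ Witt.dTwo_e_one_zero_neg_one
      (fun _ => Witt.exists_eq_dTwo) g hg hg0
  · exact ChevalleyEilenberg.rank_cohomology_three_eq_one _ Virasoro.dTwo_e_one_zero_neg_one
      (fun _ => Virasoro.exists_eq_dTwo) _ (Virasoro.isCocycleThree_pullback hg)
      (by rwa [pull])
  · obtain ⟨f, hf, hfv⟩ := Witt.exists_godbillonVey A
    refine ⟨(TrivialLieModule.equiv K (Witt K) K).symm.toLinearMap.compAlternatingMap f,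
      (ChevalleyEilenberg.isCocycleThree_iff _).mp hf, hfv, nonzero f A hA hfv⟩
  · obtain ⟨φ, hφ⟩ := (ChevalleyEilenberg.mem_coboundaries_three_iff ψ).mp hψ
    exact (DFunLike.congr_fun hφ _).trans (Witt.dTwo_e_one_zero_neg_one φ)
  · obtain ⟨f, hf, hfv⟩ := Witt.exists_godbillonVey A
    refine ⟨(TrivialLieModule.equiv K (Virasoro K) K).symm.toLinearMap.compAlternatingMap
        (f.compLinearMap (Virasoro.toWitt K)),
      (ChevalleyEilenberg.isCocycleThree_iff _).mp (Virasoro.isCocycleThree_pullback hf),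
      fun n m k => (pull f n m k).trans (hfv n m k), fun n m => ?_, ?_⟩
    · exact (AlternatingMap.compLinearMap_triple f (Virasoro.toWitt K) _ _ _).trans
        (f.map_coord_zero 2 rfl)
    · exact ne_of_eq_of_ne (pull f 1 0 (-1)) (nonzero f A hA hfv)
  · obtain ⟨φ, hφ⟩ := (ChevalleyEilenberg.mem_coboundaries_three_iff ψ).mp hψ
    exact (DFunLike.congr_fun hφ _).trans (Virasoro.dTwo_e_one_zero_neg_one φ)
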